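/- Let $q$ be a complex number with $|q|<1$, and write $(a;q)_n=\prod_{j=0}^{n-1}(1-aq^j)$ and $(a;q)_\infty=\lim_{n\to\infty}(a;q)_n$. Let $$\omega(q)=\sum_{n=0}^{\infty}\frac{q^{2n^2+2n}}{(q;q^2)_{n+1}^2},\qquad \nu(q)=\sum_{n=0}^{\infty}\frac{q^{n^2+n}}{(-q;q^2)_{n+1}},\qquad \psi(q)=\sum_{n=0}^{\infty}q^{n(n+1)/2}.$$ For a positive integer $m$ let $p_\nu(m)$ be the number of partitions of $m$ into distinct parts in which each odd part is less than twice the smallest part. Then $$\sum_{m=1}^{\infty}p_\nu(m)q^m=\sum_{n=1}^{\infty}q^n(-q^{n+1};q)_n(-q^{2n+2};q^2)_\infty .$$ Adding the term $n=0$, which is $(-q^2;q^2)_\infty$, gives $$(-q^2;q^2)_\infty+\sum_{m=1}^{\infty}p_\nu(m)q^m=\sum_{n=0}^{\infty}q^n(-q^{n+1};q)_n(-q^{2n+2};q^2)_\infty ,$$ and $$\sum_{n=0}^{\infty}q^n(-q^{n+1};q)_n(-q^{2n+2};q^2)_\infty=q\,\omega(q^2)+(-q^2;q^2)_\infty\,\psi(q^2)=\nu(-q),$$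 where all the series converge. -/

import Mathlib

open scoped Topology

/-- The finite `q`-Pochhammer symbol `(a; q)_n = ∏_{j=0}^{n-1} (1 - a q^j)`. -/
def qPoch (a q : ℂ) (n : ℕ) : ℂ := ∏ j ∈ Finset.range n, (1 - a * q ^ j)

/-- The infinite `q`-Pochhammer symbol `(a; q)_∞`; for `‖q‖ < 1` it is the limit of `(a; q)_n`,
see `tendsto_qPoch`. -/
noncomputable def qPochInf (a q : ℂ) : ℂ := ∏' j : ℕ, (1 - a * q ^ j)

/-- The third order mock theta function `ω(q) = ∑_{n ≥ 0} q^(2n²+2n) / (q; q²)_{n+1}²`. -/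
noncomputable def mockOmega (q : ℂ) : ℂ :=
  ∑' n : ℕ, q ^ (2 * n ^ 2 + 2 * n) / qPoch q (q ^ 2) (n + 1) ^ 2

/-- The third order mock theta function `ν(q) = ∑_{n ≥ 0} q^(n²+n) / (-q; q²)_{n+1}`. -/
noncomputable def mockNu (q : ℂ) : ℂ :=
  ∑' n : ℕ, q ^ (n ^ 2 + n) / qPoch (-q) (q ^ 2) (n + 1)

/-- Ramanujan's theta function `ψ(q) = ∑_{n ≥ 0} q^(n(n+1)/2)`. -/
noncomputable def ramanujanPsi (q : ℂ) : ℂ := ∑' n : ℕ, q ^ (n + 1).choose 2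

/-- The smallest part of a (nonempty) partition. -/
noncomputable def smallestPart {m : ℕ} (p : Nat.Partition m) : ℕ := sInf {i : ℕ | i ∈ p.parts}

/-- `p_ν(m)`: the number of partitions of `m` into distinct parts in which each odd part is less
than twice the smallest part. -/
noncomputable def pNu (m : ℕ) : ℕ :=
  Nat.card {p : Nat.Partition m //
    p.parts.Nodup ∧ ∀ i ∈ p.parts, Odd i → i < 2 * smallestPart p}

/-- The general term `q^n (-q^(n+1); q)_n (-q^(2n+2); q²)_∞`. -/
noncomputable def nuTerm (q : ℂ) (n : ℕ) : ℂ :=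
  q ^ n * qPoch (-q ^ (n + 1)) q n * qPochInf (-q ^ (2 * n + 2)) (q ^ 2)

theorem summable_norm_qPoch_aux (a : ℂ) {q : ℂ} (hq : ‖q‖ < 1) :
    Summable fun j : ℕ => ‖-(a * q ^ j)‖ := by
  simpa [norm_mul, norm_pow] using
    (summable_geometric_of_lt_one (norm_nonneg q) hq).mul_left ‖a‖

/-- `(a; q)_∞` is the limit of `(a; q)_n`. -/
theorem tendsto_qPoch (a : ℂ) {q : ℂ} (hq : ‖q‖ < 1) :
    Filter.Tendsto (qPoch a q) Filter.atTop (𝓝 (qPochInf a q)) := by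
  have h := (multipliable_one_add_of_summable
    (summable_norm_qPoch_aux a hq)).hasProd.tendsto_prod_nat
  simp only [← sub_eq_add_neg] at h
  exact h

theorem qPoch_factor_ne_zero {a q : ℂ} (ha : ‖a‖ < 1) (hq : ‖q‖ < 1) (j : ℕ) :
    1 - a * q ^ j ≠ 0 := by
  intro h
  have h1 : ‖a * q ^ j‖ = 1 := by rw [← sub_eq_zero.mp h, norm_one]
  have h2 : ‖q‖ ^ j ≤ 1 := pow_le_one₀ (norm_nonneg q) hq.le
  rw [norm_mul, norm_pow] at h1
  nlinarith [norm_nonneg a]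

theorem qPochInf_ne_zero {a q : ℂ} (ha : ‖a‖ < 1) (hq : ‖q‖ < 1) : qPochInf a q ≠ 0 := by
  have h := tprod_one_add_ne_zero_of_summable (f := fun j : ℕ => -(a * q ^ j))
    (fun j => by simpa only [← sub_eq_add_neg] using qPoch_factor_ne_zero ha hq j)
    (summable_norm_qPoch_aux a hq)
  simp only [← sub_eq_add_neg] at h
  exact h

/-- The series that defines `ω` converges (with nonzero denominators) in the unit disc. -/
theorem summable_mockOmega {q : ℂ} (hq : ‖q‖ < 1) :
    Summable fun n : ℕ => q ^ (2 * n ^ 2 + 2 * n) / qPoch q (q ^ 2) (n + 1) ^ 2 := by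
  have hq2 : ‖q ^ 2‖ < 1 := by
    rw [norm_pow]; exact pow_lt_one₀ (norm_nonneg q) hq two_ne_zero
  have hs : Summable fun n : ℕ => ‖q ^ (2 * n ^ 2 + 2 * n)‖ := by
    refine Summable.of_nonneg_of_le (fun n => norm_nonneg _) (fun n => ?_)
      (summable_geometric_of_lt_one (norm_nonneg q) hq)
    rw [norm_pow]
    exact pow_le_pow_of_le_one (norm_nonneg q) hq.le (by nlinarith)
  have ht := (((tendsto_qPoch q hq2).comp (Filter.tendsto_add_atTop_nat 1)).pow 2).inv₀
    (pow_ne_zero 2 (qPochInf_ne_zero hq hq2))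
  rw [← Nat.cofinite_eq_atTop] at ht
  simp only [div_eq_mul_inv]
  exact Summable.mul_tendsto_const hs ht

/-- The series that defines `ν` converges (with nonzero denominators) in the unit disc. -/
theorem summable_mockNu {q : ℂ} (hq : ‖q‖ < 1) :
    Summable fun n : ℕ => q ^ (n ^ 2 + n) / qPoch (-q) (q ^ 2) (n + 1) := by
  have hq2 : ‖q ^ 2‖ < 1 := by
    rw [norm_pow]; exact pow_lt_one₀ (norm_nonneg q) hq two_ne_zero
  have hs : Summable fun n : ℕ => ‖q ^ (n ^ 2 + n)‖ := by
    refine Summable.of_nonneg_of_le (fun n => norm_nonneg _) (fun n => ?_)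
      (summable_geometric_of_lt_one (norm_nonneg q) hq)
    rw [norm_pow]
    exact pow_le_pow_of_le_one (norm_nonneg q) hq.le (by nlinarith)
  have ht := ((tendsto_qPoch (-q) hq2).comp (Filter.tendsto_add_atTop_nat 1)).inv₀
    (qPochInf_ne_zero (by rwa [norm_neg]) hq2)
  rw [← Nat.cofinite_eq_atTop] at ht
  simp only [div_eq_mul_inv]
  exact Summable.mul_tendsto_const hs ht

/-- The series that defines `ψ` converges in the unit disc. -/
theorem summable_ramanujanPsi {q : ℂ} (hq : ‖q‖ < 1) :
    Summable fun n : ℕ => q ^ (n + 1).choose 2 := by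
  refine Summable.of_norm_bounded (summable_geometric_of_lt_one (norm_nonneg q) hq) (fun n => ?_)
  rw [norm_pow]
  refine pow_le_pow_of_le_one (norm_nonneg q) hq.le ?_
  rw [Nat.choose_succ_succ' n 1, Nat.choose_one_right]
  exact Nat.le_add_right _ _

open Filter

/-! Both analytic identities come from functional equations in an auxiliary variable. For the mock
theta identity, put `p = q²`. Then ν(-q) is `psiQuot p x` at `x = q`, and `psiQuot_eq` relates `x`
to `xp`. Iterating it produces `∑ x p^j / (x²; p²)_{j+1}`, plus a remainder tending to `ψ(p) / (p;
p²)_∞`. Euler's identity turns the remainder into the ψ term, and Fine's identity turns the sum into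
`q ω(q²)`. For the product series, insert `z`: `∑ q^n nuProd q z n` and `nuSeries q z` both satisfy
`F(z) = 1 + q(1 + zq) F(zq²)`. Their difference is bounded along `z = q^(2N)` and the factor tends
to `q`, so `eq_zero_of_bounded_of_recurrence` makes them equal at `z = 1`. Fine's identity is proved
the same way. The partition statement is a double count of `nuSets`, by minimum and by sum. -/

/-! ### q-Pochhammer symbols: recurrences, uniform bounds, Euler's identity -/

theorem qPoch_zero (a q : ℂ) : qPoch a q 0 = 1 := by simp [qPoch]

theorem qPoch_succ (a q : ℂ) (n : ℕ) : qPoch a q (n + 1) = qPoch a q n * (1 - a * q ^ n) :=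
  Finset.prod_range_succ _ _

theorem qPoch_succ' (a q : ℂ) (n : ℕ) : qPoch a q (n + 1) = (1 - a) * qPoch (a * q) q n := by
  rw [qPoch, Finset.prod_range_succ', mul_comm, qPoch]
  simp only [pow_zero, mul_one, pow_succ']
  congr 1
  exact Finset.prod_congr rfl fun j _ => by ring

theorem qPoch_ne_zero {a q : ℂ} (ha : ‖a‖ < 1) (hq : ‖q‖ < 1) (n : ℕ) : qPoch a q n ≠ 0 :=
  Finset.prod_ne_zero_iff.mpr fun j _ => qPoch_factor_ne_zero ha hq j

theorem qPochInf_eq_mul {a q : ℂ} (hq : ‖q‖ < 1) :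
    qPochInf a q = (1 - a) * qPochInf (a * q) q := by
  refine tendsto_nhds_unique ((tendsto_qPoch a hq).comp (tendsto_add_atTop_nat 1)) ?_
  refine ((tendsto_qPoch (a * q) hq).const_mul (1 - a)).congr fun n => ?_
  exact (qPoch_succ' a q n).symm

theorem one_sub_ne_zero_of_norm_lt {a : ℂ} (ha : ‖a‖ < 1) : 1 - a ≠ 0 := by
  rintro h
  rw [← sub_eq_zero.mp h, norm_one] at ha
  exact lt_irrefl _ ha

/-- The reciprocals `1 / (a; q)_n` are bounded uniformly for `‖a‖ ≤ r < 1`. -/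
theorem exists_norm_inv_qPoch_le {r : ℝ} (hr0 : 0 ≤ r) (hr : r < 1) {q : ℂ} (hq : ‖q‖ < 1) :
    ∃ K : ℝ, ∀ a : ℂ, ‖a‖ ≤ r → ∀ n, ‖(qPoch a q n)⁻¹‖ ≤ K := by
  have hr' : ‖(r : ℂ)‖ < 1 := by simpa [abs_of_nonneg hr0] using hr
  have hq' : ‖((‖q‖ : ℝ) : ℂ)‖ < 1 := by simpa using hq
  have ht := ((tendsto_qPoch (r : ℂ) hq').inv₀ (qPochInf_ne_zero hr' hq')).norm
  obtain ⟨K, hK⟩ := ht.bddAbove_range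
  refine ⟨K, fun a ha n => ?_⟩
  refine le_trans ?_ (hK ⟨n, rfl⟩)
  have hpos : 0 < ‖qPoch (r : ℂ) (‖q‖ : ℝ) n‖ := norm_pos_iff.mpr (qPoch_ne_zero hr' hq' n)
  simp only [norm_inv]
  -- Compare factor by factor with the real symbol `(r; ‖q‖)_n`: `‖1 - a q^j‖ ≥ 1 - r ‖q‖^j`.
  refine inv_anti₀ hpos ?_
  simp only [qPoch, norm_prod]
  refine Finset.prod_le_prod (fun _ _ => norm_nonneg _) fun j _ => ?_
  have h1 : ‖q‖ ^ j ≤ 1 := pow_le_one₀ (norm_nonneg q) hq.le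
  have h2 : 0 ≤ ‖q‖ ^ j := by positivity
  have h3 : ‖(1 - (r : ℂ) * ((‖q‖ : ℝ) : ℂ) ^ j)‖ = 1 - r * ‖q‖ ^ j := by
    rw [← Complex.ofReal_pow, ← Complex.ofReal_mul, ← Complex.ofReal_one, ← Complex.ofReal_sub,
      Complex.norm_real, Real.norm_eq_abs, abs_of_nonneg]
    nlinarith
  rw [h3]
  have h4 := norm_sub_norm_le (1 : ℂ) (a * q ^ j)
  rw [norm_one, norm_mul, norm_pow] at h4
  nlinarith

theorem norm_qPoch_sub_one_le (a : ℂ) {q : ℂ} (hq : ‖q‖ < 1) (n : ℕ) :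
    ‖qPoch a q n - 1‖ ≤ Real.exp (‖a‖ / (1 - ‖q‖)) - 1 := by
  have h := Finset.norm_prod_one_add_sub_one_le (Finset.range n) fun j => -(a * q ^ j)
  simp only [← sub_eq_add_neg] at h
  refine h.trans (sub_le_sub_right (Real.exp_le_exp.mpr ?_) 1)
  refine ((summable_norm_qPoch_aux a hq).sum_le_tsum _ fun _ _ => norm_nonneg _).trans ?_
  simp only [norm_neg, norm_mul, norm_pow]
  rw [tsum_mul_left, tsum_geometric_of_lt_one (norm_nonneg q) hq, div_eq_mul_inv]

theorem norm_qPochInf_sub_one_le (a : ℂ) {q : ℂ} (hq : ‖q‖ < 1) :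
    ‖qPochInf a q - 1‖ ≤ Real.exp (‖a‖ / (1 - ‖q‖)) - 1 :=
  le_of_tendsto ((tendsto_qPoch a hq).sub_const 1).norm
    (Eventually.of_forall fun n => norm_qPoch_sub_one_le a hq n)

theorem norm_qPoch_le (a : ℂ) {q : ℂ} (hq : ‖q‖ < 1) (n : ℕ) :
    ‖qPoch a q n‖ ≤ Real.exp (‖a‖ / (1 - ‖q‖)) := by
  have h1 := norm_qPoch_sub_one_le a hq n
  have h2 := norm_sub_norm_le (qPoch a q n) 1
  rw [norm_one] at h2
  linarith

theorem norm_qPochInf_le (a : ℂ) {q : ℂ} (hq : ‖q‖ < 1) :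
    ‖qPochInf a q‖ ≤ Real.exp (‖a‖ / (1 - ‖q‖)) :=
  le_of_tendsto (tendsto_qPoch a hq).norm (Eventually.of_forall fun n => norm_qPoch_le a hq n)

theorem tendsto_exp_norm_div_sub_one {ι : Type*} {l : Filter ι} {a : ι → ℂ}
    (ha : Tendsto a l (𝓝 0)) (c : ℝ) :
    Tendsto (fun i => Real.exp (‖a i‖ / c) - 1) l (𝓝 0) := by
  have h : Tendsto (fun i => ‖a i‖ / c) l (𝓝 0) := by simpa using ha.norm.div_const c
  simpa using ((Real.continuous_exp.tendsto 0).comp h).sub_const 1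

/-- The exponential bound on `(a; q)_n - 1` does not depend on `n`, so the length may vary with the
index. -/
theorem tendsto_qPoch_one {ι : Type*} {l : Filter ι} {a : ι → ℂ} (ha : Tendsto a l (𝓝 0))
    {q : ℂ} (hq : ‖q‖ < 1) (n : ι → ℕ) : Tendsto (fun i => qPoch (a i) q (n i)) l (𝓝 1) :=
  tendsto_iff_norm_sub_tendsto_zero.mpr <| squeeze_zero (fun _ => norm_nonneg _)
    (fun i => norm_qPoch_sub_one_le (a i) hq (n i)) (tendsto_exp_norm_div_sub_one ha _)

theorem tendsto_qPochInf_one {ι : Type*} {l : Filter ι} {a : ι → ℂ} (ha : Tendsto a l (𝓝 0))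
    {q : ℂ} (hq : ‖q‖ < 1) : Tendsto (fun i => qPochInf (a i) q) l (𝓝 1) :=
  tendsto_iff_norm_sub_tendsto_zero.mpr <| squeeze_zero (fun _ => norm_nonneg _)
    (fun i => norm_qPochInf_sub_one_le (a i) hq) (tendsto_exp_norm_div_sub_one ha _)

theorem qPoch_two_mul (y : ℂ) (n : ℕ) :
    qPoch y y (2 * n) = qPoch y (y ^ 2) n * qPoch (y ^ 2) (y ^ 2) n := by
  induction n with
  | zero => simp [qPoch]
  | succ n ih =>
    rw [show 2 * (n + 1) = 2 * n + 1 + 1 by ring, qPoch_succ, qPoch_succ, ih, qPoch_succ,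
      qPoch_succ]
    ring

theorem qPoch_mul_qPoch_neg (a q : ℂ) (n : ℕ) :
    qPoch a q n * qPoch (-a) q n = qPoch (a ^ 2) (q ^ 2) n := by
  rw [qPoch, qPoch, qPoch, ← Finset.prod_mul_distrib]
  exact Finset.prod_congr rfl fun j _ => by ring

theorem norm_sq_lt_one {q : ℂ} (hq : ‖q‖ < 1) : ‖q ^ 2‖ < 1 := by
  rw [norm_pow]; exact pow_lt_one₀ (norm_nonneg q) hq two_ne_zero

/-- Euler: partitions into odd parts are equinumerous with partitions into distinct parts. -/
theorem qPochInf_mul_qPochInf_neg {y : ℂ} (hy : ‖y‖ < 1) :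
    qPochInf y (y ^ 2) * qPochInf (-y) y = 1 := by
  have hy2 := norm_sq_lt_one hy
  have h1 : qPochInf y y = qPochInf y (y ^ 2) * qPochInf (y ^ 2) (y ^ 2) := by
    refine tendsto_nhds_unique ((tendsto_qPoch y hy).comp
      (tendsto_id.const_mul_atTop' (two_pos : (0 : ℕ) < 2))) ?_
    refine ((tendsto_qPoch y hy2).mul (tendsto_qPoch (y ^ 2) hy2)).congr fun n => ?_
    exact (qPoch_two_mul y n).symm
  have h2 : qPochInf y y * qPochInf (-y) y = qPochInf (y ^ 2) (y ^ 2) :=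
    tendsto_nhds_unique (((tendsto_qPoch y hy).mul (tendsto_qPoch (-y) hy)).congr
      fun n => qPoch_mul_qPoch_neg y y n) (tendsto_qPoch _ hy2)
  refine mul_left_cancel₀ (qPochInf_ne_zero hy hy) ?_
  rw [mul_one, mul_left_comm, h2, ← h1]

/-! ### Uniqueness for recurrences, and telescoping -/

/-- A bounded solution of `D N = c N * D (N + 1)` vanishes if `c` tends to a limit in the open unit
disc. -/
theorem eq_zero_of_bounded_of_recurrence {D c : ℕ → ℂ} {l : ℂ} (hl : ‖l‖ < 1)
    (hc : Tendsto c atTop (𝓝 l)) {B : ℝ} (hB : ∀ n, ‖D n‖ ≤ B)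
    (h : ∀ n, D n = c n * D (n + 1)) : D 0 = 0 := by
  obtain ⟨r, hr, hr1⟩ := exists_between hl
  have hr0 : 0 ≤ r := (norm_nonneg l).trans hr.le
  obtain ⟨N, hN⟩ := eventually_atTop.mp (hc.norm.eventually_lt_const hr)
  have hpow : ∀ k n, N ≤ n → ‖D n‖ ≤ r ^ k * B := by
    intro k
    induction k with
    | zero => intro n _; simpa using hB n
    | succ k ih =>
      intro n hn
      rw [h n, norm_mul, pow_succ', mul_assoc]
      exact mul_le_mul (hN n hn).le (ih (n + 1) (by omega)) (norm_nonneg _) hr0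
  have hDN : D N = 0 := by
    rw [← norm_le_zero_iff]
    refine ge_of_tendsto' (f := fun k => r ^ k * B) (x := atTop) ?_ fun k => hpow k N le_rfl
    simpa using (tendsto_pow_atTop_nhds_zero_of_lt_one hr0 hr1).mul_const B
  -- The contraction holds only from `N` on; the recurrence carries the zero back to index 0.
  have hback : ∀ n, D n = 0 → D 0 = 0 := by
    intro n
    induction n with
    | zero => exact id
    | succ n ih => exact fun hn => ih (by rw [h n, hn, mul_zero])
  exact hback N hDN

theorem tsum_eq_of_telescoping {t u : ℕ → ℂ} {l : ℂ} (ht : Summable t)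
    (h : ∀ n, t n = u n - u (n + 1)) (hu : Tendsto u atTop (𝓝 l)) : ∑' n, t n = u 0 - l := by
  refine tendsto_nhds_unique ht.hasSum.tendsto_sum_nat ?_
  refine (hu.const_sub (u 0)).congr fun n => ?_
  rw [← Finset.sum_range_sub']
  exact Finset.sum_congr rfl fun i _ => (h i).symm

/-! ### Iterating the functional equation of ν -/

theorem choose_succ_two (n : ℕ) : (n + 1 + 1).choose 2 = (n + 1).choose 2 + (n + 1) := by
  rw [Nat.choose_succ_succ' (n + 1) 1, Nat.choose_one_right, add_comm]

theorem two_mul_choose_two (n : ℕ) : 2 * (n + 1).choose 2 = n ^ 2 + n := by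
  induction n with
  | zero => rfl
  | succ n ih => rw [choose_succ_two, mul_add, ih]; ring

theorem le_choose_two (n : ℕ) : n ≤ (n + 1).choose 2 := by
  have := two_mul_choose_two n
  nlinarith [Nat.le_self_pow two_ne_zero n]

/-- The series `∑ p^(n(n+1)/2) / (x; p)_{n+1}`, which is `ψ(p)` at `x = 0`. -/
noncomputable def psiQuot (p x : ℂ) : ℂ := ∑' n : ℕ, p ^ (n + 1).choose 2 / qPoch x p (n + 1)

theorem norm_psiQuot_term_le {p x : ℂ} (hp : ‖p‖ < 1) {K : ℝ}
    (hK : ∀ n, ‖(qPoch x p n)⁻¹‖ ≤ K) (n : ℕ) :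
    ‖p ^ (n + 1).choose 2 / qPoch x p (n + 1)‖ ≤ ‖p‖ ^ n * K := by
  rw [div_eq_mul_inv, norm_mul, norm_pow]
  exact mul_le_mul (pow_le_pow_of_le_one (norm_nonneg p) hp.le (le_choose_two n)) (hK _)
    (norm_nonneg _) (by positivity)

theorem summable_psiQuot {p x : ℂ} (hp : ‖p‖ < 1) (hx : ‖x‖ < 1) :
    Summable fun n : ℕ => p ^ (n + 1).choose 2 / qPoch x p (n + 1) := by
  obtain ⟨K, hK⟩ := exists_norm_inv_qPoch_le (norm_nonneg x) hx hp
  exact .of_norm_bounded ((summable_geometric_of_lt_one (norm_nonneg p) hp).mul_right K)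
    (norm_psiQuot_term_le hp (hK x le_rfl))

theorem norm_mul_lt_one {x p : ℂ} (hx : ‖x‖ < 1) (hp : ‖p‖ < 1) : ‖x * p‖ < 1 := by
  rw [norm_mul]
  exact mul_lt_one_of_nonneg_of_lt_one_left (norm_nonneg x) hx hp.le

/-- With `t_n(x)` the summand, `(1 - x²) t_n(x) - t_n(xp)` telescopes through `u_n = (1 - x) x
t_n(x)`, and `u_0 = x`. -/
theorem psiQuot_eq {p x : ℂ} (hp : ‖p‖ < 1) (hx : ‖x‖ < 1) :
    psiQuot p x = (x + psiQuot p (x * p)) / (1 - x ^ 2) := by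
  have hs := summable_psiQuot hp hx
  have hs' := summable_psiQuot hp (norm_mul_lt_one hx hp)
  have h1 := one_sub_ne_zero_of_norm_lt hx
  have htel := tsum_eq_of_telescoping
    (t := fun n => (1 - x ^ 2) * (p ^ (n + 1).choose 2 / qPoch x p (n + 1)) -
      p ^ (n + 1).choose 2 / qPoch (x * p) p (n + 1))
    (u := fun n => (1 - x) * x * (p ^ (n + 1).choose 2 / qPoch x p (n + 1))) (l := 0)
    ((hs.mul_left _).sub hs') (fun n => ?_)
    (by simpa using hs.tendsto_atTop_zero.const_mul ((1 - x) * x))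
  · rw [(hs.mul_left _).tsum_sub hs', tsum_mul_left] at htel
    change (1 - x ^ 2) * psiQuot p x - psiQuot p (x * p) = _ at htel
    have h2 := one_sub_ne_zero_of_norm_lt (norm_sq_lt_one hx)
    rw [eq_div_iff h2, mul_comm, ← sub_eq_iff_eq_add, htel]
    simp only [qPoch_succ, qPoch_zero]
    simp
    field_simp
  · have e1 : qPoch (x * p) p (n + 1) = qPoch x p (n + 1 + 1) / (1 - x) := by
      rw [qPoch_succ' x, mul_div_cancel_left₀ _ h1]
    have h3 := qPoch_ne_zero hx hp (n + 1)
    have h4 := qPoch_factor_ne_zero hx hp (n + 1)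
    simp only [e1, qPoch_succ x p (n + 1), choose_succ_two, pow_add p _ (n + 1)]
    field_simp
    ring

theorem norm_mul_pow_le {x p : ℂ} (hp : ‖p‖ < 1) (N : ℕ) : ‖x * p ^ N‖ ≤ ‖x‖ := by
  rw [norm_mul, norm_pow]
  exact mul_le_of_le_one_right (norm_nonneg x) (pow_le_one₀ (norm_nonneg p) hp.le)

theorem tendsto_mul_pow_zero (x : ℂ) {p : ℂ} (hp : ‖p‖ < 1) :
    Tendsto (fun N => x * p ^ N) atTop (𝓝 0) := by
  simpa using (tendsto_pow_atTop_nhds_zero_of_norm_lt_one hp).const_mul x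

theorem psiQuot_zero (p : ℂ) : psiQuot p 0 = ramanujanPsi p := by
  simp [psiQuot, ramanujanPsi, qPoch]

theorem tendsto_psiQuot {p x : ℂ} (hp : ‖p‖ < 1) (hx : ‖x‖ < 1) :
    Tendsto (fun N => psiQuot p (x * p ^ N)) atTop (𝓝 (ramanujanPsi p)) := by
  obtain ⟨K, hK⟩ := exists_norm_inv_qPoch_le (norm_nonneg x) hx hp
  rw [← psiQuot_zero]
  refine tendsto_tsum_of_dominated_convergence
    ((summable_geometric_of_lt_one (norm_nonneg p) hp).mul_right K) (fun n => ?_)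
    (Eventually.of_forall fun N n => norm_psiQuot_term_le hp (hK _ (norm_mul_pow_le hp N)) n)
  have h0 : qPoch 0 p (n + 1) = 1 := by simp [qPoch]
  rw [h0]
  exact tendsto_const_nhds.div (tendsto_qPoch_one (tendsto_mul_pow_zero x hp) hp _) one_ne_zero

theorem psiQuot_eq_sum {p x : ℂ} (hp : ‖p‖ < 1) (hx : ‖x‖ < 1) (N : ℕ) :
    psiQuot p x = ∑ j ∈ Finset.range N, x * p ^ j / qPoch (x ^ 2) (p ^ 2) (j + 1) +
      psiQuot p (x * p ^ N) / qPoch (x ^ 2) (p ^ 2) N := by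
  induction N with
  | zero => simp [qPoch]
  | succ N ih =>
    rw [ih, psiQuot_eq hp ((norm_mul_pow_le hp N).trans_lt hx), Finset.sum_range_succ, add_assoc,
      mul_assoc x, ← pow_succ]
    congr 1
    have h1 := qPoch_ne_zero (norm_sq_lt_one hx) (norm_sq_lt_one hp) N
    have h2 := qPoch_factor_ne_zero (norm_sq_lt_one hx) (norm_sq_lt_one hp) N
    have e : (x * p ^ N) ^ 2 = x ^ 2 * (p ^ 2) ^ N := by ring
    rw [qPoch_succ, e]
    field_simp

/-! ### Fine's identity -/

/-- The series `∑ b^n / (b; p)_{n+1}`. -/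
noncomputable def fineSeries (p b : ℂ) : ℂ := ∑' n : ℕ, b ^ n / qPoch b p (n + 1)

theorem norm_fineSeries_term_le {p b : ℂ} {r K : ℝ} (hb : ‖b‖ ≤ r)
    (hK : ∀ n, ‖(qPoch b p n)⁻¹‖ ≤ K) (n : ℕ) : ‖b ^ n / qPoch b p (n + 1)‖ ≤ r ^ n * K := by
  rw [div_eq_mul_inv, norm_mul, norm_pow]
  exact mul_le_mul (pow_le_pow_left₀ (norm_nonneg b) hb n) (hK _) (norm_nonneg _)
    (pow_nonneg ((norm_nonneg b).trans hb) n)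

theorem summable_fineSeries {p b : ℂ} (hp : ‖p‖ < 1) (hb : ‖b‖ < 1) :
    Summable fun n : ℕ => b ^ n / qPoch b p (n + 1) := by
  obtain ⟨K, hK⟩ := exists_norm_inv_qPoch_le (norm_nonneg b) hb hp
  exact .of_norm_bounded ((summable_geometric_of_lt_one (norm_nonneg b) hb).mul_right K)
    (norm_fineSeries_term_le le_rfl (hK b le_rfl))

/-- Telescoping again, through `1 - b` times the summand, whose value at 0 is 1. -/
theorem fineSeries_eq {p b : ℂ} (hp : ‖p‖ < 1) (hb : ‖b‖ < 1) :
    fineSeries p b = (1 + b ^ 2 * p * fineSeries p (b * p)) / (1 - b) ^ 2 := by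
  have hs := summable_fineSeries hp hb
  have hs' := summable_fineSeries hp (norm_mul_lt_one hb hp)
  have h1 := one_sub_ne_zero_of_norm_lt hb
  have htel := tsum_eq_of_telescoping
    (t := fun n => (1 - b) ^ 2 * (b ^ n / qPoch b p (n + 1)) -
      b ^ 2 * p * ((b * p) ^ n / qPoch (b * p) p (n + 1)))
    (u := fun n => (1 - b) * (b ^ n / qPoch b p (n + 1))) (l := 0)
    ((hs.mul_left _).sub (hs'.mul_left _)) (fun n => ?_)
    (by simpa using hs.tendsto_atTop_zero.const_mul (1 - b))
  · rw [(hs.mul_left _).tsum_sub (hs'.mul_left _), tsum_mul_left, tsum_mul_left] at htel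
    change (1 - b) ^ 2 * fineSeries p b - b ^ 2 * p * fineSeries p (b * p) = _ at htel
    rw [eq_div_iff (pow_ne_zero 2 h1), mul_comm, ← sub_eq_iff_eq_add, htel]
    simp only [qPoch_succ, qPoch_zero]
    simp [h1]
  · have e1 : qPoch (b * p) p (n + 1) = qPoch b p (n + 1 + 1) / (1 - b) := by
      rw [qPoch_succ' b, mul_div_cancel_left₀ _ h1]
    have h3 := qPoch_ne_zero hb hp (n + 1)
    have h4 := qPoch_factor_ne_zero hb hp (n + 1)
    simp only [e1, qPoch_succ b p (n + 1), mul_pow]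
    field_simp
    ring

/-- The series `∑ b^(2n) p^(n²) / (b; p)_{n+1}²`. -/
noncomputable def omegaSeries (p b : ℂ) : ℂ :=
  ∑' n : ℕ, b ^ (2 * n) * p ^ n ^ 2 / qPoch b p (n + 1) ^ 2

theorem norm_omegaSeries_term_le {p b : ℂ} (hp : ‖p‖ < 1) {r K : ℝ} (hb : ‖b‖ ≤ r) (hr : r < 1)
    (hK : ∀ n, ‖(qPoch b p n)⁻¹‖ ≤ K) (n : ℕ) :
    ‖b ^ (2 * n) * p ^ n ^ 2 / qPoch b p (n + 1) ^ 2‖ ≤ r ^ n * K ^ 2 := by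
  rw [div_eq_mul_inv, norm_mul, norm_mul, norm_pow, norm_pow, ← inv_pow, norm_pow]
  have hr0 := (norm_nonneg b).trans hb
  have h1 : ‖b‖ ^ (2 * n) ≤ r ^ n :=
    (pow_le_pow_left₀ (norm_nonneg b) hb _).trans
      (pow_le_pow_of_le_one hr0 hr.le (by omega))
  have h2 : ‖p‖ ^ n ^ 2 ≤ 1 := pow_le_one₀ (norm_nonneg p) hp.le
  exact mul_le_mul ((mul_le_mul h1 h2 (by positivity) (by positivity)).trans_eq (mul_one _))
    (pow_le_pow_left₀ (norm_nonneg _) (hK _) 2) (by positivity) (by positivity)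

theorem summable_omegaSeries {p b : ℂ} (hp : ‖p‖ < 1) (hb : ‖b‖ < 1) :
    Summable fun n : ℕ => b ^ (2 * n) * p ^ n ^ 2 / qPoch b p (n + 1) ^ 2 := by
  obtain ⟨K, hK⟩ := exists_norm_inv_qPoch_le (norm_nonneg b) hb hp
  exact .of_norm_bounded ((summable_geometric_of_lt_one (norm_nonneg b) hb).mul_right (K ^ 2))
    (norm_omegaSeries_term_le hp le_rfl hb (hK b le_rfl))

/-- No telescoping is needed: after the first term, the summand at `n + 1` is `b² p / (1 - b)²`
times the summand at `n` for `bp`. -/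
theorem omegaSeries_eq {p b : ℂ} (hp : ‖p‖ < 1) (hb : ‖b‖ < 1) :
    omegaSeries p b = (1 + b ^ 2 * p * omegaSeries p (b * p)) / (1 - b) ^ 2 := by
  rw [omegaSeries, (summable_omegaSeries hp hb).tsum_eq_zero_add, omegaSeries, ← tsum_mul_left,
    add_div, ← tsum_div_const]
  congr 1
  · simp [qPoch]
  · refine tsum_congr fun n => ?_
    rw [qPoch_succ' b, mul_pow (1 - b), mul_div_assoc', div_div, mul_comm (_ ^ 2) ((1 - b) ^ 2)]
    congr 1
    ring

/-- Fine's identity `∑ b^n / (b; p)_{n+1} = ∑ b^(2n) p^(n²) / (b; p)_{n+1}²`. -/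
theorem fineSeries_eq_omegaSeries {p b : ℂ} (hp : ‖p‖ < 1) (hb : ‖b‖ < 1) :
    fineSeries p b = omegaSeries p b := by
  obtain ⟨K, hK⟩ := exists_norm_inv_qPoch_le (norm_nonneg b) hb hp
  have hg := summable_geometric_of_lt_one (norm_nonneg b) hb
  have hN := fun N => norm_mul_pow_le (x := b) hp N
  have hB : ∀ N, ‖fineSeries p (b * p ^ N) - omegaSeries p (b * p ^ N)‖ ≤
      (∑' n, ‖b‖ ^ n * K) + ∑' n, ‖b‖ ^ n * K ^ 2 := fun N =>
    (norm_sub_le _ _).trans <| add_le_add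
      (tsum_of_norm_bounded (hg.mul_right K).hasSum
        (norm_fineSeries_term_le (hN N) (hK _ (hN N))))
      (tsum_of_norm_bounded (hg.mul_right (K ^ 2)).hasSum
        (norm_omegaSeries_term_le hp (hN N) hb (hK _ (hN N))))
  have ht := tendsto_mul_pow_zero b hp
  -- The inhomogeneous terms cancel in the difference; the remaining factor tends to 0.
  have hc : Tendsto (fun N => (b * p ^ N) ^ 2 * p / (1 - b * p ^ N) ^ 2) atTop
      (𝓝 (0 ^ 2 * p / (1 - 0) ^ 2)) :=
    ((ht.pow 2).mul_const p).div ((ht.const_sub 1).pow 2) (by simp)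
  have h := eq_zero_of_bounded_of_recurrence (by simp) hc hB fun N => by
    rw [fineSeries_eq hp ((hN N).trans_lt hb), omegaSeries_eq hp ((hN N).trans_lt hb), pow_succ p N,
      ← mul_assoc]
    ring
  simpa [sub_eq_zero] using h

theorem mockOmega_eq_fineSeries {q : ℂ} (hq : ‖q‖ < 1) :
    mockOmega q = fineSeries (q ^ 2) q := by
  rw [fineSeries_eq_omegaSeries (norm_sq_lt_one hq) hq, mockOmega, omegaSeries]
  refine tsum_congr fun n => ?_
  rw [← pow_mul, ← pow_add, add_comm]

/-! ### The mock theta identity -/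

theorem mockNu_neg_eq_psiQuot (q : ℂ) : mockNu (-q) = psiQuot (q ^ 2) q := by
  refine tsum_congr fun n => ?_
  rw [neg_neg, neg_sq, ← pow_mul, two_mul_choose_two, Even.neg_pow]
  rw [← two_mul_choose_two]
  exact even_two_mul _

theorem mockNu_neg_eq {q : ℂ} (hq : ‖q‖ < 1) :
    mockNu (-q) =
      q * mockOmega (q ^ 2) + qPochInf (-q ^ 2) (q ^ 2) * ramanujanPsi (q ^ 2) := by
  have hp := norm_sq_lt_one hq
  have hpp := norm_sq_lt_one hp
  rw [mockNu_neg_eq_psiQuot, mockOmega_eq_fineSeries hp]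
  have heuler := qPochInf_mul_qPochInf_neg hp
  have hne := qPochInf_ne_zero hp hpp
  -- Euler's identity at `y = q²`.
  have e : qPochInf (-q ^ 2) (q ^ 2) * ramanujanPsi (q ^ 2) =
      ramanujanPsi (q ^ 2) / qPochInf (q ^ 2) ((q ^ 2) ^ 2) := by
    rw [eq_div_iff hne]
    linear_combination ramanujanPsi (q ^ 2) * heuler
  rw [e]
  refine tendsto_nhds_unique (tendsto_const_nhds (f := (atTop : Filter ℕ))) ?_
  refine Tendsto.congr (fun N => (psiQuot_eq_sum hp hq N).symm) ?_
  refine Tendsto.add ?_ ((tendsto_psiQuot hp hq).div (tendsto_qPoch _ hpp) hne)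
  rw [fineSeries]
  refine ((summable_fineSeries hpp hp).hasSum.mul_left q).tendsto_sum_nat.congr fun N => ?_
  exact Finset.sum_congr rfl fun j _ => (mul_div_assoc _ _ _).symm

/-! ### The product series equals ν(-q) -/

/-- The product `(-z q^(n+1); q)_n (-z q^(2n+2); q²)_∞`. -/
noncomputable def nuProd (q z : ℂ) (n : ℕ) : ℂ :=
  qPoch (-(z * q ^ (n + 1))) q n * qPochInf (-(z * q ^ (2 * n + 2))) (q ^ 2)

theorem exists_norm_nuProd_le {q : ℂ} (hq : ‖q‖ < 1) :
    ∃ K : ℝ, ∀ z : ℂ, ‖z‖ ≤ 1 → ∀ n, ‖nuProd q z n‖ ≤ K := by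
  have hq2 := norm_sq_lt_one hq
  refine ⟨Real.exp (1 / (1 - ‖q‖)) * Real.exp (1 / (1 - ‖q ^ 2‖)), fun z hz n => ?_⟩
  have hz' : ∀ k, ‖-(z * q ^ k)‖ ≤ 1 := fun k => by
    rw [norm_neg]; exact (norm_mul_pow_le hq k).trans hz
  have h1 := sub_pos.mpr hq
  have h2 := sub_pos.mpr hq2
  rw [nuProd, norm_mul]
  gcongr
  · exact (norm_qPoch_le _ hq n).trans (Real.exp_le_exp.mpr (by gcongr; exact hz' _))
  · exact (norm_qPochInf_le _ hq2).trans (Real.exp_le_exp.mpr (by gcongr; exact hz' _))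

theorem tendsto_nuProd {q : ℂ} (hq : ‖q‖ < 1) (z : ℂ) :
    Tendsto (nuProd q z) atTop (𝓝 1) := by
  have h : ∀ f : ℕ → ℕ, Tendsto f atTop atTop →
      Tendsto (fun n => -(z * q ^ f n)) atTop (𝓝 0) := fun f hf => by
    simpa using ((tendsto_mul_pow_zero z hq).comp hf).neg
  have h1 := tendsto_qPoch_one (h (fun n => n + 1) (tendsto_add_atTop_nat 1)) hq id
  have h2 := tendsto_qPochInf_one (h (fun n => 2 * n + 2)
    (tendsto_atTop_mono (fun n => by simp only [id]; omega) tendsto_id)) (norm_sq_lt_one hq)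
  rw [← mul_one (1 : ℂ)]
  exact h1.mul h2

theorem nuProd_succ (q z : ℂ) (n : ℕ) :
    nuProd q z (n + 1) = (1 + z * q ^ (n + 2)) * nuProd q (z * q ^ 2) n := by
  rw [nuProd, nuProd, qPoch_succ']
  ring_nf

theorem nuProd_succ_succ {q : ℂ} (hq : ‖q‖ < 1) (z : ℂ) (n : ℕ) :
    nuProd q z (n + 2) = (1 + z * q ^ (2 * n + 3)) * nuProd q (z * q ^ 2) n := by
  rw [nuProd, nuProd, qPoch_succ, qPoch_succ,
    qPochInf_eq_mul (a := -(z * q ^ 2 * q ^ (2 * n + 2))) (norm_sq_lt_one hq)]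
  ring_nf

theorem nuProd_one {q : ℂ} (hq : ‖q‖ < 1) (z : ℂ) : nuProd q z 1 = nuProd q z 0 := by
  rw [nuProd, nuProd, qPochInf_eq_mul (a := -(z * q ^ (2 * 0 + 2))) (norm_sq_lt_one hq),
    qPoch_succ, qPoch_zero, qPoch_zero]
  ring_nf

theorem norm_pow_mul_nuProd_le {q z : ℂ} {K : ℝ} (hK : ∀ n, ‖nuProd q z n‖ ≤ K) (n : ℕ) :
    ‖q ^ n * nuProd q z n‖ ≤ ‖q‖ ^ n * K := by
  rw [norm_mul, norm_pow]
  exact mul_le_mul_of_nonneg_left (hK n) (by positivity)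

theorem summable_pow_mul_nuProd {q z : ℂ} (hq : ‖q‖ < 1) (hz : ‖z‖ ≤ 1) :
    Summable fun n => q ^ n * nuProd q z n := by
  obtain ⟨K, hK⟩ := exists_norm_nuProd_le hq
  exact .of_norm_bounded ((summable_geometric_of_lt_one (norm_nonneg q) hq).mul_right K)
    (norm_pow_mul_nuProd_le (hK z hz))

theorem norm_mul_sq_le_one {q z : ℂ} (hq : ‖q‖ < 1) (hz : ‖z‖ ≤ 1) : ‖z * q ^ 2‖ ≤ 1 :=
  (norm_mul_pow_le hq 2).trans hz

/-- `nuProd_succ` and `nuProd_succ_succ` express consecutive products through the same `nuProd q (z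
* q ^ 2) n`, so their differences telescope to the limit 1. The starting value `nuProd q z 1` equals
the term at `n = 0`. -/
theorem tsum_pow_mul_nuProd {q z : ℂ} (hq : ‖q‖ < 1) (hz : ‖z‖ ≤ 1) :
    ∑' n, q ^ n * nuProd q z n =
      1 + q * (1 + z * q) * ∑' n, q ^ n * nuProd q (z * q ^ 2) n := by
  have hs := summable_pow_mul_nuProd hq hz
  have hs1 : Summable fun n => q ^ (n + 1) * nuProd q z (n + 1) := (summable_nat_add_iff 1).mpr hs
  have hs' := summable_pow_mul_nuProd hq (norm_mul_sq_le_one hq hz)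
  have htel := tsum_eq_of_telescoping
    (t := fun n => q * (1 + z * q) * (q ^ n * nuProd q (z * q ^ 2) n) -
      q ^ (n + 1) * nuProd q z (n + 1))
    (u := fun n => nuProd q z (n + 1)) (l := 1) ((hs'.mul_left _).sub hs1) (fun n => ?_)
    ((tendsto_nuProd hq z).comp (tendsto_add_atTop_nat 1))
  · rw [(hs'.mul_left _).tsum_sub hs1, tsum_mul_left, zero_add, nuProd_one hq] at htel
    rw [hs.tsum_eq_zero_add, pow_zero, one_mul]
    linear_combination -htel
  · rw [nuProd_succ_succ hq, nuProd_succ]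
    ring

/-- The two-variable series `∑ z^n q^(n²+n) / (q; q²)_{n+1}`. -/
noncomputable def nuSeries (q z : ℂ) : ℂ :=
  ∑' n : ℕ, z ^ n * ((q ^ 2) ^ (n + 1).choose 2 / qPoch q (q ^ 2) (n + 1))

theorem norm_nuSeries_term_le {q z : ℂ} (hz : ‖z‖ ≤ 1) (n : ℕ) :
    ‖z ^ n * ((q ^ 2) ^ (n + 1).choose 2 / qPoch q (q ^ 2) (n + 1))‖ ≤
      ‖(q ^ 2) ^ (n + 1).choose 2 / qPoch q (q ^ 2) (n + 1)‖ := by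
  rw [norm_mul, norm_pow]
  exact mul_le_of_le_one_left (norm_nonneg _) (pow_le_one₀ (norm_nonneg z) hz)

theorem summable_nuSeries {q z : ℂ} (hq : ‖q‖ < 1) (hz : ‖z‖ ≤ 1) :
    Summable fun n : ℕ => z ^ n * ((q ^ 2) ^ (n + 1).choose 2 / qPoch q (q ^ 2) (n + 1)) :=
  .of_norm_bounded (summable_psiQuot (norm_sq_lt_one hq) hq).norm (norm_nuSeries_term_le hz)

/-- Subtracting `q` times the series at `zq²` puts `1 - q^(2n+1)` into the term at `n`, cancelling
the last denominator factor; the term at 0 becomes 1. -/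
theorem nuSeries_eq {q z : ℂ} (hq : ‖q‖ < 1) (hz : ‖z‖ ≤ 1) :
    nuSeries q z = 1 + q * (1 + z * q) * nuSeries q (z * q ^ 2) := by
  have hs := summable_nuSeries hq hz
  have hs' := summable_nuSeries hq (norm_mul_sq_le_one hq hz)
  have hw := hs.sub (hs'.mul_left q)
  have h := hw.tsum_eq_zero_add
  rw [hs.tsum_sub (hs'.mul_left q), tsum_mul_left] at h
  have hterm : ∀ n : ℕ, z ^ (n + 1) *
        ((q ^ 2) ^ (n + 1 + 1).choose 2 / qPoch q (q ^ 2) (n + 1 + 1)) -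
      q * ((z * q ^ 2) ^ (n + 1) *
        ((q ^ 2) ^ (n + 1 + 1).choose 2 / qPoch q (q ^ 2) (n + 1 + 1))) =
      z * q ^ 2 *
        ((z * q ^ 2) ^ n * ((q ^ 2) ^ (n + 1).choose 2 / qPoch q (q ^ 2) (n + 1))) := by
    intro n
    have h3 := qPoch_ne_zero hq (norm_sq_lt_one hq) (n + 1)
    have h4 := qPoch_factor_ne_zero hq (norm_sq_lt_one hq) (n + 1)
    rw [qPoch_succ q _ (n + 1), choose_succ_two, pow_add (q ^ 2) _ (n + 1)]
    field_simp
    ring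
  simp only [hterm] at h
  rw [tsum_mul_left] at h
  change nuSeries q z - q * nuSeries q (z * q ^ 2) =
    _ + z * q ^ 2 * nuSeries q (z * q ^ 2) at h
  have h0 : 1 / (1 - q) - q * (1 / (1 - q)) = 1 := by
    have := one_sub_ne_zero_of_norm_lt hq
    field_simp
  simp [qPoch] at h h0
  linear_combination h + h0

theorem tsum_pow_mul_nuProd_eq_nuSeries {q : ℂ} (hq : ‖q‖ < 1) :
    ∑' n, q ^ n * nuProd q 1 n = nuSeries q 1 := by
  obtain ⟨K, hK⟩ := exists_norm_nuProd_le hq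
  have hq2 := norm_sq_lt_one hq
  have hN : ∀ N, ‖(q ^ 2) ^ N‖ ≤ 1 := fun N => by
    rw [norm_pow]; exact pow_le_one₀ (norm_nonneg _) hq2.le
  have hB : ∀ N, ‖∑' n, q ^ n * nuProd q ((q ^ 2) ^ N) n - nuSeries q ((q ^ 2) ^ N)‖ ≤
      (∑' n, ‖q‖ ^ n * K) +
        ∑' n : ℕ, ‖(q ^ 2) ^ (n + 1).choose 2 / qPoch q (q ^ 2) (n + 1)‖ := fun N =>
    (norm_sub_le _ _).trans <| add_le_add
      (tsum_of_norm_bounded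
        ((summable_geometric_of_lt_one (norm_nonneg q) hq).mul_right K).hasSum
        (norm_pow_mul_nuProd_le (hK _ (hN N))))
      (tsum_of_norm_bounded (summable_psiQuot hq2 hq).norm.hasSum
        (norm_nuSeries_term_le (hN N)))
  have hc : Tendsto (fun N => q * (1 + (q ^ 2) ^ N * q)) atTop (𝓝 q) := by
    simpa using (((tendsto_pow_atTop_nhds_zero_of_norm_lt_one hq2).mul_const q).const_add
      1).const_mul q
  have h := eq_zero_of_bounded_of_recurrence hq hc hB fun N => by
    rw [tsum_pow_mul_nuProd hq (hN N), nuSeries_eq hq (hN N), ← pow_succ]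
    ring
  simpa [sub_eq_zero] using h

theorem nuTerm_eq (q : ℂ) (n : ℕ) : nuTerm q n = q ^ n * nuProd q 1 n := by
  simp only [nuTerm, nuProd, one_mul, mul_assoc]

theorem summable_nuTerm {q : ℂ} (hq : ‖q‖ < 1) : Summable fun n => nuTerm q n := by
  simp only [nuTerm_eq]
  exact summable_pow_mul_nuProd hq (by simp)

theorem tsum_nuTerm {q : ℂ} (hq : ‖q‖ < 1) : ∑' n, nuTerm q n = mockNu (-q) := by
  simp only [nuTerm_eq]
  rw [tsum_pow_mul_nuProd_eq_nuSeries hq, mockNu_neg_eq_psiQuot]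
  simp [nuSeries, psiQuot]

/-! ### Partitions counted by smallest part -/

/-- Nonempty finite sets of positive integers whose odd elements are less than twice the
minimum. -/
def nuSets : Set (Finset ℕ) :=
  {T | T.Nonempty ∧ 0 ∉ T ∧ ∀ i ∈ T, Odd i → i < 2 * sInf {i | i ∈ T}}

/-- The integers that may accompany the smallest part `n`. -/
def nuTail (n : ℕ) : Set ℕ := {i | n < i ∧ (Odd i → i < 2 * n)}

theorem pow_sum_eq_prod (q : ℂ) (T : Finset ℕ) : q ^ T.val.sum = ∏ i ∈ T, q ^ i := by
  rw [Finset.prod_pow_eq_pow_sum, Finset.sum, Multiset.map_id']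

theorem sInf_mem_finset {T : Finset ℕ} (hT : T.Nonempty) : sInf {i | i ∈ T} ∈ T :=
  Nat.sInf_mem (s := {i | i ∈ T}) hT

theorem sInf_le_of_mem_finset {T : Finset ℕ} {i : ℕ} (hi : i ∈ T) : sInf {i | i ∈ T} ≤ i :=
  Nat.sInf_le (s := {i | i ∈ T}) hi

/-- Partitions counted by `pNu` correspond to the sets in `nuSets` with the given sum. -/
noncomputable def nuPartitionEquiv {m : ℕ} (hm : m ≠ 0) :
    {p : Nat.Partition m // p.parts.Nodup ∧ ∀ i ∈ p.parts, Odd i → i < 2 * smallestPart p} ≃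
      {T : nuSets // T.1.val.sum = m} where
  toFun p := ⟨⟨⟨p.1.parts, p.2.1⟩, by
    refine ⟨?_, fun h => lt_irrefl 0 (p.1.parts_pos h), p.2.2⟩
    rw [Finset.nonempty_iff_ne_empty]
    intro h
    refine hm ?_
    rw [← p.1.parts_sum]
    have := congrArg Finset.val h
    simp only [Finset.empty_val] at this
    rw [this, Multiset.sum_zero]⟩, p.1.parts_sum⟩
  invFun T := ⟨⟨T.1.1.val, fun {i} hi => Nat.pos_of_ne_zero fun h => T.1.2.2.1 (h ▸ hi), T.2⟩,
    T.1.1.nodup, T.1.2.2.2⟩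
  left_inv _ := rfl
  right_inv _ := rfl

theorem insert_mem_nuSets {n : ℕ} (hn : n ≠ 0) {S : Finset ℕ} (hS : ∀ i ∈ S, i ∈ nuTail n) :
    insert n S ∈ nuSets ∧ sInf {i | i ∈ insert n S} = n := by
  have hmin : sInf {i | i ∈ insert n S} = n := by
    refine le_antisymm (sInf_le_of_mem_finset (Finset.mem_insert_self n S)) ?_
    rcases Finset.mem_insert.mp (sInf_mem_finset (Finset.insert_nonempty n S)) with h | h
    · exact h.ge
    · exact (hS _ h).1.le
  refine ⟨⟨Finset.insert_nonempty n S, fun h => ?_, fun i hi ho => ?_⟩, hmin⟩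
  · rcases Finset.mem_insert.mp h with h | h
    · exact hn h.symm
    · exact Nat.not_lt_zero _ (hS _ h).1
  · rw [hmin]
    rcases Finset.mem_insert.mp hi with h | h
    · omega
    · exact (hS _ h).2 ho

/-- The sets in `nuSets` with minimum `n` are obtained by adjoining `n` to a finite subset of
`nuTail n`. -/
noncomputable def nuTailEquiv {n : ℕ} (hn : n ≠ 0) :
    {S : Finset ℕ // ∀ i ∈ S, i ∈ nuTail n} ≃ {T : nuSets // sInf {i | i ∈ T.1} = n} where
  toFun S := ⟨⟨insert n S.1, (insert_mem_nuSets hn S.2).1⟩, (insert_mem_nuSets hn S.2).2⟩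
  invFun T := ⟨T.1.1.erase n, fun i hi => by
    obtain ⟨hne, hi⟩ := Finset.mem_erase.mp hi
    have h1 := sInf_le_of_mem_finset hi
    have h2 := T.1.2.2.2 i hi
    rw [T.2] at h1 h2
    exact ⟨lt_of_le_of_ne h1 hne.symm, h2⟩⟩
  left_inv S := Subtype.ext <| Finset.erase_insert fun h => lt_irrefl n (S.2 n h).1
  right_inv T := Subtype.ext <| Subtype.ext <| Finset.insert_erase <| by
    have := sInf_mem_finset T.1.2.1
    rwa [T.2] at this

/-- The endpoint `2n` is even, so all of `(n, 2n]` is allowed; beyond it only even integers are.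
This gives the two factors of `nuTerm`. -/
theorem mem_nuTail_iff {n i : ℕ} :
    i ∈ nuTail n ↔ i ∈ Finset.Ico (n + 1) (2 * n + 1) ∨ ∃ j, 2 * n + 2 + 2 * j = i := by
  rw [nuTail, Set.mem_ofPred_eq, Finset.mem_Ico]
  constructor
  · rintro ⟨h1, h2⟩
    rcases Nat.even_or_odd i with h | h
    · obtain ⟨k, hk⟩ := h
      rcases le_or_gt i (2 * n) with h3 | h3
      · omega
      · exact Or.inr ⟨k - n - 1, by omega⟩
    · have := h2 h
      omega
  · rintro (h | ⟨j, rfl⟩)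
    · refine ⟨by omega, fun ho => ?_⟩
      obtain ⟨k, hk⟩ := ho
      omega
    · refine ⟨by omega, fun ho => ?_⟩
      obtain ⟨k, hk⟩ := ho
      omega

open Classical in
theorem hasProd_nuTail {q : ℂ} (hq : ‖q‖ < 1) (n : ℕ) :
    HasProd (fun i => 1 + (nuTail n).indicator (fun i => q ^ i) i)
      (qPoch (-q ^ (n + 1)) q n * qPochInf (-q ^ (2 * n + 2)) (q ^ 2)) := by
  have h1 : HasProd (fun i => if i ∈ Finset.Ico (n + 1) (2 * n + 1) then 1 + q ^ i else 1)
      (qPoch (-q ^ (n + 1)) q n) := by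
    have h := hasProd_prod_of_ne_finset_one (L := SummationFilter.unconditional ℕ)
      (f := fun i => if i ∈ Finset.Ico (n + 1) (2 * n + 1) then 1 + q ^ i else 1)
      (s := Finset.Ico (n + 1) (2 * n + 1)) fun i hi => if_neg hi
    convert h using 1
    rw [Finset.prod_congr rfl fun i hi => if_pos hi, Finset.prod_Ico_eq_prod_range, qPoch]
    refine Finset.prod_congr (by congr 1; omega) fun j _ => ?_
    ring
  have hinj : Function.Injective fun j => 2 * n + 2 + 2 * j := fun a b h => by
    simp only at h
    omega
  have h2 : HasProd (fun i => if ∃ j, 2 * n + 2 + 2 * j = i then 1 + q ^ i else 1)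
      (qPochInf (-q ^ (2 * n + 2)) (q ^ 2)) := by
    refine (hinj.hasProd_iff fun i hi => if_neg hi).mp ?_
    have h := (multipliable_one_add_of_summable
      (summable_norm_qPoch_aux (-q ^ (2 * n + 2)) (norm_sq_lt_one hq))).hasProd
    simp only [← sub_eq_add_neg] at h
    refine h.congr_fun ?_
    intro j
    simp
    ring
  refine (h1.mul h2).congr_fun ?_
  intro i
  by_cases ha : i ∈ Finset.Ico (n + 1) (2 * n + 1)
  · have hb : ¬ ∃ j, 2 * n + 2 + 2 * j = i := by
      rintro ⟨j, rfl⟩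
      rw [Finset.mem_Ico] at ha
      omega
    rw [Set.indicator_of_mem (mem_nuTail_iff.mpr (Or.inl ha)), if_pos ha, if_neg hb, mul_one]
  · by_cases hb : ∃ j, 2 * n + 2 + 2 * j = i
    · rw [Set.indicator_of_mem (mem_nuTail_iff.mpr (Or.inr hb)), if_neg ha, if_pos hb, one_mul]
    · rw [Set.indicator_of_notMem (fun h => (mem_nuTail_iff.mp h).elim ha hb), if_neg ha,
        if_neg hb, one_mul, add_zero]

theorem summable_pow_sum {q : ℂ} (hq : ‖q‖ < 1) :
    Summable fun T : Finset ℕ => q ^ T.val.sum := by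
  simp only [pow_sum_eq_prod]
  refine summable_finsetProd_of_summable_norm ?_
  simpa only [norm_pow] using summable_geometric_of_lt_one (norm_nonneg q) hq

/-- Expand `∏ (1 + f i)` over finite sets, with `f` the indicator of `nuTail n` times `q^i`; sets
not inside `nuTail n` contribute 0. -/
theorem tsum_nuTail {q : ℂ} (hq : ‖q‖ < 1) (n : ℕ) :
    ∑' S : {S : Finset ℕ // ∀ i ∈ S, i ∈ nuTail n}, q ^ S.1.val.sum =
      qPoch (-q ^ (n + 1)) q n * qPochInf (-q ^ (2 * n + 2)) (q ^ 2) := by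
  have hsum : Summable fun i => ‖(nuTail n).indicator (fun i => q ^ i) i‖ := by
    refine .of_nonneg_of_le (fun _ => norm_nonneg _)
      (fun i => norm_indicator_le_norm_self (fun i => q ^ i) i) ?_
    simpa only [norm_pow] using summable_geometric_of_lt_one (norm_nonneg q) hq
  rw [← (hasProd_nuTail hq n).tprod_eq, tprod_one_add (summable_finsetProd_of_summable_norm hsum),
    ← tsum_subtype_eq_of_support_subset (s := {S : Finset ℕ | ∀ i ∈ S, i ∈ nuTail n})]
  · refine tsum_congr fun S => ?_
    rw [pow_sum_eq_prod]
    exact Finset.prod_congr rfl fun i hi => (Set.indicator_of_mem (S.2 i hi) _).symm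
  · intro S hS i hi
    by_contra h
    exact hS (Finset.prod_eq_zero hi (Set.indicator_of_notMem h _))

theorem tsum_nuSets_sInf_eq {q : ℂ} (hq : ‖q‖ < 1) {n : ℕ} (hn : n ≠ 0) :
    ∑' T : {T : nuSets // sInf {i | i ∈ T.1} = n}, q ^ T.1.1.val.sum = nuTerm q n := by
  rw [nuTerm, mul_assoc, ← tsum_nuTail hq n, ← tsum_mul_left, ← (nuTailEquiv hn).tsum_eq]
  refine tsum_congr fun S => ?_
  have hS : n ∉ S.1 := fun h => lt_irrefl n (S.2 n h).1
  change q ^ (insert n S.1).val.sum = _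
  rw [pow_sum_eq_prod, Finset.prod_insert hS, pow_sum_eq_prod]

theorem hasSum_pNu {q : ℂ} (hq : ‖q‖ < 1) :
    HasSum (fun m : ℕ => (pNu (m + 1) : ℂ) * q ^ (m + 1)) (∑' n : ℕ, nuTerm q (n + 1)) := by
  have hF : Summable fun T : nuSets => q ^ T.1.val.sum := (summable_pow_sum hq).subtype nuSets
  have hmin := hF.hasSum.tsum_fiberwise fun T => sInf {i | i ∈ T.1}
  have hsum := hF.hasSum.tsum_fiberwise fun T => T.1.val.sum
  -- Both fibres over 0 are empty, so both sums may start at index 1.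
  have hmin0 : IsEmpty ((fun T : nuSets => sInf {i | i ∈ T.1}) ⁻¹' {0}) := by
    refine ⟨fun T => T.1.2.2.1 ?_⟩
    have h := sInf_mem_finset T.1.2.1
    rwa [show sInf {i | i ∈ T.1.1} = 0 from T.2] at h
  have hsum0 : IsEmpty ((fun T : nuSets => T.1.val.sum) ⁻¹' {0}) := by
    refine ⟨fun T => T.1.2.2.1 ?_⟩
    obtain ⟨i, hi⟩ := T.1.2.1
    have h : i = 0 := Multiset.sum_eq_zero_iff.mp (show T.1.1.val.sum = 0 from T.2) i hi
    exact h ▸ hi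
  rw [← hasSum_nat_add_iff' 1] at hmin hsum
  simp only [Finset.sum_range_one, tsum_empty, sub_zero] at hmin hsum
  have hA : ∑' n : ℕ, nuTerm q (n + 1) = ∑' T : nuSets, q ^ T.1.val.sum := by
    rw [← hmin.tsum_eq]
    exact tsum_congr fun n => (tsum_nuSets_sInf_eq hq n.succ_ne_zero).symm
  rw [hA]
  refine hsum.congr_fun fun m => ?_
  -- On a fibre of the sum the summand is constant, so it contributes its cardinality times
  -- `q^(m+1)`.
  rw [pNu, Nat.card_congr (nuPartitionEquiv m.succ_ne_zero), ← nsmul_eq_mul, ← tsum_const]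
  exact tsum_congr fun T => by rw [T.2]

theorem theorem4p1 (q : ℂ) (hq : ‖q‖ < 1) :
    Summable (fun n : ℕ => nuTerm q n) ∧
    HasSum (fun m : ℕ => (pNu (m + 1) : ℂ) * q ^ (m + 1)) (∑' n : ℕ, nuTerm q (n + 1)) ∧
    ∑' n : ℕ, nuTerm q n =
      qPochInf (-q ^ 2) (q ^ 2) + ∑' m : ℕ, (pNu (m + 1) : ℂ) * q ^ (m + 1) ∧
    ∑' n : ℕ, nuTerm q n =
      q * mockOmega (q ^ 2) + qPochInf (-q ^ 2) (q ^ 2) * ramanujanPsi (q ^ 2) ∧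
    q * mockOmega (q ^ 2) + qPochInf (-q ^ 2) (q ^ 2) * ramanujanPsi (q ^ 2) = mockNu (-q) := by
  refine ⟨summable_nuTerm hq, hasSum_pNu hq, ?_, ?_, (mockNu_neg_eq hq).symm⟩
  · rw [(hasSum_pNu hq).tsum_eq, (summable_nuTerm hq).tsum_eq_zero_add]
    simp [nuTerm, qPoch_zero]
  · rw [tsum_nuTerm hq, mockNu_neg_eq hq]
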